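/- Let $(G,+)$ be an Abelian, Hausdorff, locally compact, second-countable topological group with its Borel $\sigma$-algebra, and let $\lambda_G$ be a Haar measure on $G$. Let $\mathrm M(G)$ be the space of locally finite positive Borel measures on $G$ (finite on compact sets), with the $\sigma$-algebra generated by the maps $\xi\mapsto\xi(K)$, $K\subset G$ compact, and let $\emptyset\in \mathrm M(G)$ denote the zero measure. Put $\tau_t\xi=\xi(\cdot+t)$ for $t\in G$. A measure $\mathrm P$ on $\mathrm M(G)$ is called stationary if it is $\sigma$-finite and its image under $\tau_t$ is $\mathrm P$ for every $t\in G$. A measure $\mathrm P_0$ on $\mathrm M(G)$ is the Palm measure of $\mathrm P$ if $$\mathrm P_0(A)=\int_{\mathrm M(G)}\int_G \omega(t)\,\mathbf 1(\tau_t\xi\in A)\,\xi(\mathrm dt)\,\mathrm P(\mathrm d\xi)$$ for every measurable $A\subset\mathrm M(G)$ and every measurable $\omega:G\to\mathbb R_+$ with $\int_G\omega\,\mathrm d\lambda_G=1$. Let $\mathrm F(G)$ be the set of continuous functions $B:G\to G$ with $B_0=0$ such that $\int_G \mathbf 1_K(t+B_t)\,\xi(\mathrm dt)<\infty$ for all $\xi\in\mathrm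 M(G)$ and all compact $K\subset G$, with the $\sigma$-algebra generated by the evaluations $B\mapsto B_t$, $t\in G$. A measure $\nu$ on $\mathrm F(G)$ is weakly stationary if it is $\sigma$-finite and, for every $t\in G$, its image under $\theta_t:B\mapsto (B_{t+s}-B_t)_{s\in G}$ is $\nu$. For $\xi\in\mathrm M(G)$ and $B\in\mathrm F(G)$, let $\Gamma(\xi,B)\in\mathrm M(G)$ be the image of $\xi$ under $t\mapsto t+B_t$, and for measures $\mathrm P_0$ on $\mathrm M(G)$ and $\nu$ on $\mathrm F(G)$ let $\mathrm P_0^\nu$ be the image of $\mathrm P_0\otimes\nu$ under $\Gamma$. Let $\mathrm N(G)\subset\mathrm M(G)$ be the set of counting measures, that is, the measures $\sum_{x\in F}m_x\delta_x$ where $F\subset G$ is locally finite (it has finitely many points in each compact set) and $m_x>0$ are real numbers. A measure on $\mathrm M(G)$ is supported on $\mathrm N(G)$ if almost every $\xi$ belongs to $\mathrm N(G)$. Let $\mathrm P_0$ be the Palm measure of a stationary measure $\mathrm P$ on $\mathrm M(G)$ and let $\nu$ be a weakly stationary measure on $\mathrm F(G)$ such that $\mathrm P_0^\nu$ is $\sigma$-finite.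 Assume that $\mathrm P$ is supported on $\mathrm N(G)$. Then there is exactly one stationary measure $\mathrm P^\nu$ on $\mathrm M(G)$ with $\mathrm P^\nu(\{\emptyset\})=0$ whose Palm measure is $\mathrm P_0^\nu$, and this measure $\mathrm P^\nu$ is supported on $\mathrm N(G)$. -/

import Mathlib

open MeasureTheory
open scoped NNReal ENNReal

noncomputable section

namespace PalmPerturbation

/-- The space `M(G)` of locally finite positive Borel measures on `G`: those that are finite
on every compact set. -/
@[ext]
structure LFMeasure (G : Type*) [TopologicalSpace G] [MeasurableSpace G] where
  toMeasure : Measure G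
  lt_top : ∀ K : Set G, IsCompact K → toMeasure K < ∞

namespace LFMeasure

variable {G : Type*} [TopologicalSpace G] [MeasurableSpace G]

/-- The σ-algebra on `M(G)` generated by the evaluations `ξ ↦ ξ(K)`, `K` compact. -/
instance : MeasurableSpace (LFMeasure G) :=
  ⨆ (K : Set G) (_ : IsCompact K),
    MeasurableSpace.comap (fun ξ : LFMeasure G => ξ.toMeasure K) inferInstance

/-- The zero measure `∅`. -/
instance : Zero (LFMeasure G) := ⟨⟨0, fun _ _ => by simp⟩⟩

/-- Counting measures: `ξ = ∑_{x ∈ F} m(x) δ_x` with `F` a locally finite set (every compact set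
contains finitely many points of `F`) and real weights `m(x) > 0`. -/
def IsCounting (ξ : LFMeasure G) : Prop :=
  ∃ (F : Set G) (m : G → ℝ≥0),
    (∀ K : Set G, IsCompact K → (F ∩ K).Finite) ∧ (∀ x ∈ F, 0 < m x) ∧
      ξ.toMeasure = Measure.sum fun x : F => m x • Measure.dirac (x : G)

variable [AddCommGroup G] [IsTopologicalAddGroup G] [BorelSpace G]

/-- The translation `τ_t ξ = ξ(· + t)`: the image of `ξ` under `s ↦ s - t`. -/
def shift (t : G) (ξ : LFMeasure G) : LFMeasure G :=
  ⟨ξ.toMeasure.map (fun s => s - t), fun K hK => by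
    have h : MeasurableEmbedding (fun s : G => s - t) :=
      (Homeomorph.subRight t).measurableEmbedding
    rw [h.map_apply]
    exact ξ.lt_top _ ((Homeomorph.subRight t).isCompact_preimage.mpr hK)⟩

theorem shift_apply (t : G) (ξ : LFMeasure G) (K : Set G) :
    (shift t ξ).toMeasure K = ξ.toMeasure ((fun s => s - t) ⁻¹' K) :=
  (Homeomorph.subRight t).measurableEmbedding.map_apply _ _

end LFMeasure

/-- The space `F(G)` of continuous functions `B : G → G` with `B 0 = 0` whose perturbation
`t ↦ t + B t` sends every locally finite measure to a locally finite measure. -/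
@[ext]
structure PathSpace (G : Type*) [TopologicalSpace G] [MeasurableSpace G] [AddCommGroup G] where
  toFun : G → G
  continuous_toFun : Continuous toFun
  map_zero : toFun 0 = 0
  lintegral_lt_top : ∀ (ξ : LFMeasure G) (K : Set G), IsCompact K →
    ∫⁻ t, K.indicator (fun _ => (1 : ℝ≥0∞)) (t + toFun t) ∂ξ.toMeasure < ∞

namespace PathSpace

variable {G : Type*} [TopologicalSpace G] [MeasurableSpace G] [AddCommGroup G]

/-- The cylindrical σ-algebra on `F(G)`, generated by the evaluations `B ↦ B t`. -/
instance : MeasurableSpace (PathSpace G) :=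
  ⨆ t : G, MeasurableSpace.comap (fun B : PathSpace G => B.toFun t) inferInstance

variable [IsTopologicalAddGroup G] [BorelSpace G]

/-- The increment shift `θ_t B = (B_{t+s} - B_t)_s`. -/
def shift (t : G) (B : PathSpace G) : PathSpace G where
  toFun s := B.toFun (t + s) - B.toFun t
  continuous_toFun := by
    have := B.continuous_toFun
    fun_prop
  map_zero := by simp
  lintegral_lt_top ξ K hK := by
    let c : G := t + B.toFun t
    have h := B.lintegral_lt_top (LFMeasure.shift (-t) ξ) ((fun x => x - c) ⁻¹' K)
      ((Homeomorph.subRight c).isCompact_preimage.mpr hK)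
    have he : MeasurableEmbedding (fun s : G => s - -t) :=
      (Homeomorph.subRight (-t)).measurableEmbedding
    change ∫⁻ u, _ ∂(ξ.toMeasure.map (fun s => s - -t)) < ∞ at h
    rw [he.lintegral_map] at h
    refine lt_of_eq_of_lt (lintegral_congr fun s => ?_) h
    have e : s - -t + B.toFun (s - -t) - c = s + (B.toFun (t + s) - B.toFun t) := by
      have : s - -t = t + s := by abel
      rw [this]
      simp only [c]
      abel
    have hiff : s - -t + B.toFun (s - -t) ∈ (fun x => x - c) ⁻¹' K ↔
        s + (B.toFun (t + s) - B.toFun t) ∈ K := by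
      rw [Set.mem_preimage, e]
    by_cases hs : s + (B.toFun (t + s) - B.toFun t) ∈ K
    · rw [Set.indicator_of_mem hs, Set.indicator_of_mem (hiff.mpr hs)]
    · rw [Set.indicator_of_notMem hs, Set.indicator_of_notMem (fun h => hs (hiff.mp h))]

end PathSpace

variable {G : Type*} [TopologicalSpace G] [MeasurableSpace G] [AddCommGroup G]
  [IsTopologicalAddGroup G] [BorelSpace G]

/-- The perturbed measure `Γ(ξ, B) = ξ_B`: the image of `ξ` under `t ↦ t + B t`. -/
def perturb [T2Space G] (p : LFMeasure G × PathSpace G) : LFMeasure G :=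
  ⟨p.1.toMeasure.map (fun t => t + p.2.toFun t), fun K hK => by
    have hm : Measurable (fun t => t + p.2.toFun t) :=
      (continuous_id.add p.2.continuous_toFun).measurable
    have h := p.2.lintegral_lt_top p.1 K hK
    rw [Measure.map_apply hm hK.measurableSet]
    rw [← lintegral_indicator_one (hm hK.measurableSet)]
    exact h⟩

/-- A stationary measure on `M(G)`: σ-finite and invariant under all translations `τ_t`. -/
def IsStationary (P : Measure (LFMeasure G)) : Prop :=
  SigmaFinite P ∧ ∀ t : G, P.map (LFMeasure.shift t) = P

/-- A weakly stationary measure on `F(G)`: σ-finite and with stationary increments. -/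
def IsWeaklyStationary (ν : Measure (PathSpace G)) : Prop :=
  SigmaFinite ν ∧ ∀ t : G, ν.map (PathSpace.shift t) = ν

/-- `P₀` is the Palm measure of `P` with respect to the Haar measure `haar`:
`P₀(A) = ∫ ∫ ω(t) 1(τ_t ξ ∈ A) ξ(dt) P(dξ)` for every measurable `ω ≥ 0` of integral one. -/
def IsPalmMeasure (haar : Measure G) (P P₀ : Measure (LFMeasure G)) : Prop :=
  ∀ ω : G → ℝ≥0, Measurable ω → ∫⁻ t, (ω t : ℝ≥0∞) ∂haar = 1 →
    ∀ A : Set (LFMeasure G), MeasurableSet A →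
      P₀ A = ∫⁻ ξ, ∫⁻ t, (ω t : ℝ≥0∞) *
        A.indicator (fun _ => (1 : ℝ≥0∞)) (LFMeasure.shift t ξ) ∂ξ.toMeasure ∂P

/-- `P` is a stationary measure that does not charge the zero measure and has Palm measure `P₀`. -/
def IsStationaryWithPalm (haar : Measure G) (P P₀ : Measure (LFMeasure G)) : Prop :=
  IsStationary P ∧ P {0} = 0 ∧ IsPalmMeasure haar P P₀

/-- `P₀^ν`: the image of the product measure `P₀ ⊗ ν` under `Γ`. -/
def perturbedPalm [T2Space G] (P₀ : Measure (LFMeasure G)) (ν : Measure (PathSpace G)) :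
    Measure (LFMeasure G) :=
  (P₀.prod ν).map perturb

/-- `P` is supported on the set `N(G)` of counting measures. -/
def SupportedOnCounting (P : Measure (LFMeasure G)) : Prop :=
  ∀ᵐ ξ ∂P, ξ.IsCounting

/-- Translations of `M(G)` are measurable, so `Measure.map` is the genuine image measure. -/
theorem measurable_shift (t : G) : Measurable (LFMeasure.shift t : LFMeasure G → LFMeasure G) := by
  refine Measurable.of_comap_le ?_
  change MeasurableSpace.comap _ (⨆ (K : Set G) (_ : IsCompact K),
    MeasurableSpace.comap (fun ξ : LFMeasure G => ξ.toMeasure K) inferInstance) ≤ _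
  simp only [MeasurableSpace.comap_iSup, MeasurableSpace.comap_comp]
  refine iSup₂_le fun K hK => ?_
  refine le_trans (le_of_eq ?_) (le_iSup₂ ((fun s => s - t) ⁻¹' K)
    ((Homeomorph.subRight t).isCompact_preimage.mpr hK))
  congr 1
  funext ξ
  exact LFMeasure.shift_apply t ξ K

/-- Increment shifts of `F(G)` are measurable, so `Measure.map` is the genuine image measure. -/
theorem measurable_pathShift [SecondCountableTopology G] (t : G) :
    Measurable (PathSpace.shift t : PathSpace G → PathSpace G) := by
  have hev : ∀ s : G, Measurable (fun B : PathSpace G => B.toFun s) := fun s =>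
    Measurable.of_comap_le (le_iSup (fun s : G =>
      MeasurableSpace.comap (fun B : PathSpace G => B.toFun s) inferInstance) s)
  refine Measurable.of_comap_le ?_
  change MeasurableSpace.comap _ (⨆ s : G,
    MeasurableSpace.comap (fun B : PathSpace G => B.toFun s) inferInstance) ≤ _
  simp only [MeasurableSpace.comap_iSup, MeasurableSpace.comap_comp]
  refine iSup_le fun s => Measurable.comap_le ?_
  exact (hev (t + s)).sub (hev t)

end PalmPerturbation

end

/-!
A σ-finite measure `Q` on `M(G)` with `Q {0} = 0` is the Palm measure of a stationary measure if and
only if it satisfies Mecke's exchange formula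
`∫ ∫ f(τ_t ξ, -t) ξ(dt) Q(dξ) = ∫ ∫ f(ξ, t) ξ(dt) Q(dξ)`, and the stationary measure, normalised to
have no mass at `0`, is then unique (`IsMecke.existsUnique_isStationaryWithPalm`). It is given
by the inversion formula `P(A) = ∫ ∫ h(τ₋ₜ ξ, t) 1(τ₋ₜ ξ ∈ A) dt Q(dξ)`, where `h ≥ 0` is any
measurable function with `∫ h(ξ, t) ξ(dt) = 1` for `ξ ≠ 0`. All arguments about a measure and its Palm measure go through the
refined Campbell formula `∫ ∫ f(t, τ_t ξ) ξ(dt) P(dξ) = ∫ ∫ f(t, ξ) dt Q(dξ)` (`IsCampbell`), which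
extends the definition of the Palm measure from products `ω(t) 1(ξ ∈ A)` to all measurable
functions.

The exchange formula passes from `P₀` to the perturbed measure (`IsMecke.perturbedPalm`) because
`τ_{t + B t} (ξ_B) = (τ_t ξ)_{θ_t B}` and `-(t + B t) = -t + (θ_t B)(-t)`: recentring the perturbed
measure is the same as perturbing the recentred measure by the path `θ_t B`, which can be replaced
by `B` since `ν` is weakly stationary.

The set of counting measures is measurable (`measurableSet_isCounting`) and invariant under
translations, so by the Campbell formula `P` is supported on it if and only if its Palm measure is
(`IsCampbell.supportedOnCounting_iff`). A path in `F(G)` maps counting measures to counting measures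
(`LFMeasure.IsCounting.perturb`), since it maps the measure `∑_{x ∈ F} δ_x`, which is locally finite
when `F` is, to a locally finite measure.
-/

noncomputable section

open MeasureTheory ProbabilityTheory Set Filter Topology
open scoped NNReal ENNReal

namespace PalmPerturbation

/-! ### Measurable structure on the space of locally finite measures -/

/-- A measure that integrates an almost everywhere positive function to a finite value is
σ-finite. -/
theorem sigmaFinite_of_lintegral_ne_top {α : Type*} {mα : MeasurableSpace α} {μ : Measure α}
    {g : α → ℝ≥0∞} (hg : Measurable g) (hpos : ∀ᵐ x ∂μ, g x ≠ 0) (hfin : ∫⁻ x, g x ∂μ ≠ ∞) :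
    SigmaFinite μ := by
  have hfin' : ∀ᵐ x ∂μ, g x ≠ ∞ := (ae_lt_top hg hfin).mono fun _ h => h.ne
  have : IsFiniteMeasure (μ.withDensity g) := isFiniteMeasure_withDensity hfin
  rw [← withDensity_inv_same hg hpos hfin']
  refine SigmaFinite.withDensity_of_ne_top ?_
  rw [ae_withDensity_iff hg]
  exact Eventually.of_forall fun x hx => by simpa using hx

section

variable {G : Type*} [TopologicalSpace G] [MeasurableSpace G]

theorem measurable_eval_of_isCompact {K : Set G} (hK : IsCompact K) :
    Measurable fun ξ : LFMeasure G => ξ.toMeasure K :=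
  Measurable.of_comap_le (le_iSup₂ (f := fun (K : Set G) (_ : IsCompact K) =>
    MeasurableSpace.comap (fun ξ : LFMeasure G => ξ.toMeasure K) inferInstance) K hK)

theorem measurable_lfMeasure_iff {α : Type*} [MeasurableSpace α] {f : α → LFMeasure G} :
    Measurable f ↔ ∀ K : Set G, IsCompact K → Measurable fun a => (f a).toMeasure K := by
  refine ⟨fun hf K hK => (measurable_eval_of_isCompact hK).comp hf, fun h => ?_⟩
  refine Measurable.of_comap_le ?_
  change MeasurableSpace.comap _ (⨆ (K : Set G) (_ : IsCompact K),
    MeasurableSpace.comap (fun ξ : LFMeasure G => ξ.toMeasure K) inferInstance) ≤ _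
  simp only [MeasurableSpace.comap_iSup, MeasurableSpace.comap_comp]
  exact iSup₂_le fun K hK => (h K hK).comap_le

instance instIsFiniteMeasureOnCompacts (ξ : LFMeasure G) :
    IsFiniteMeasureOnCompacts ξ.toMeasure :=
  ⟨fun {K} hK => ξ.lt_top K hK⟩

variable [LocallyCompactSpace G] [SecondCountableTopology G] [BorelSpace G]

theorem measurable_toMeasure : Measurable (LFMeasure.toMeasure : LFMeasure G → Measure G) := by
  have hfin : ∀ (n : ℕ), Measurable fun ξ : LFMeasure G =>
      ξ.toMeasure.restrict (compactCovering G n) := by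
    intro n
    have hK := isCompact_compactCovering G n
    have : ∀ ξ : LFMeasure G, IsFiniteMeasure (ξ.toMeasure.restrict (compactCovering G n)) :=
      fun ξ => ⟨by simpa using ξ.lt_top _ hK⟩
    refine Measurable.measure_of_isPiSystem (S := {s | IsClosed s}) ?_ ?_ ?_ ?_
    · rw [← borel_eq_generateFrom_isClosed]; exact BorelSpace.measurable_eq
    · exact fun s hs t ht _ => IsClosed.inter hs ht
    · intro s hs
      simp only [Measure.restrict_apply (IsClosed.measurableSet hs)]
      exact measurable_eval_of_isCompact (hK.inter_left hs)
    · simpa using measurable_eval_of_isCompact hK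
  refine Measure.measurable_of_measurable_coe _ fun s hs => ?_
  have : (fun ξ : LFMeasure G => ξ.toMeasure s) =
      fun ξ : LFMeasure G => ⨆ n, ξ.toMeasure.restrict (compactCovering G n) s := by
    funext ξ
    simp only [Measure.restrict_apply hs]
    rw [← Monotone.measure_iUnion, ← inter_iUnion, iUnion_compactCovering, inter_univ]
    exact fun m n h => inter_subset_inter_right _ (compactCovering_subset G h)
  rw [this]
  exact Measurable.iSup fun n => (Measure.measurable_coe hs).comp (hfin n)

variable (G) in
/-- The tautological kernel from `M(G)` to `G`, which assigns to `ξ` the measure `ξ` itself. -/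
def lfKernel : Kernel (LFMeasure G) G := ⟨LFMeasure.toMeasure, measurable_toMeasure⟩

theorem lfKernel_apply (ξ : LFMeasure G) : lfKernel G ξ = ξ.toMeasure := rfl

/-- The zero measure is a measurable point of `M(G)`. -/
theorem measurableSet_singleton_zero : MeasurableSet ({0} : Set (LFMeasure G)) := by
  have : ({0} : Set (LFMeasure G)) = (fun ξ : LFMeasure G => ξ.toMeasure univ) ⁻¹' {0} := by
    ext ξ
    simp only [mem_singleton_iff, mem_preimage, Measure.measure_univ_eq_zero]
    exact ⟨fun h => by rw [h]; rfl, fun h => LFMeasure.ext h⟩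
  rw [this]
  exact ((Measure.measurable_coe MeasurableSet.univ).comp measurable_toMeasure)
    (measurableSet_singleton 0)

variable [T2Space G]

/-- The masses `ξ(K)` are not bounded uniformly in `ξ`, so the kernel is cut up along the values
of `⌊ξ(K)⌋`. -/
instance instIsSFiniteKernelLfKernel : IsSFiniteKernel (lfKernel G) := by
  classical
  let D : ℕ → Set G := disjointed (compactCovering G)
  have hDm : ∀ n, MeasurableSet (D n) := fun n =>
    MeasurableSet.disjointed (fun n => (isCompact_compactCovering G n).measurableSet) n
  have hDfin : ∀ n (ξ : LFMeasure G), ξ.toMeasure (D n) ≠ ∞ := fun n ξ =>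
    ((measure_mono (disjointed_subset _ n)).trans_lt
      (ξ.lt_top _ (isCompact_compactCovering G n))).ne
  have hdecomp : lfKernel G = Kernel.sum fun n => (lfKernel G).restrict (hDm n) := by
    ext1 ξ
    rw [Kernel.sum_apply]
    simp only [Kernel.restrict_apply]
    rw [← Measure.restrict_iUnion (disjoint_disjointed _) hDm, iUnion_disjointed,
      iUnion_compactCovering, Measure.restrict_univ]
  suffices h : ∀ n, IsSFiniteKernel ((lfKernel G).restrict (hDm n)) by
    rw [hdecomp]; infer_instance
  intro n
  let A : ℕ → Set (LFMeasure G) := fun m => {ξ | ⌊(ξ.toMeasure (D n)).toNNReal⌋₊ = m}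
  have hAm : ∀ m, MeasurableSet (A m) := fun m =>
    (Nat.measurable_floor.comp (ENNReal.measurable_toNNReal.comp
      ((Measure.measurable_coe (hDm n)).comp measurable_toMeasure))) (measurableSet_singleton m)
  have hdecomp' : (lfKernel G).restrict (hDm n) =
      Kernel.sum fun m => Kernel.piecewise (hAm m) ((lfKernel G).restrict (hDm n)) 0 := by
    ext1 ξ
    rw [Kernel.sum_apply]
    ext1 s hs
    rw [Measure.sum_apply _ hs, tsum_eq_single ⌊(ξ.toMeasure (D n)).toNNReal⌋₊]
    · rw [Kernel.piecewise_apply, if_pos (show ξ ∈ A _ from rfl)]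
    · intro m hm
      rw [Kernel.piecewise_apply, if_neg (show ξ ∉ A m from fun h => hm h.symm)]
      rfl
  rw [hdecomp']
  have (m : ℕ) : IsFiniteKernel (Kernel.piecewise (hAm m) ((lfKernel G).restrict (hDm n)) 0) := by
    refine ⟨⟨(m : ℝ≥0∞) + 1, by finiteness, fun ξ => ?_⟩⟩
    rw [Kernel.piecewise_apply]
    split_ifs with h
    · rw [Kernel.restrict_apply, Measure.restrict_apply_univ, lfKernel_apply,
        ← ENNReal.coe_toNNReal (hDfin n ξ)]
      have h1 := Nat.lt_floor_add_one (ξ.toMeasure (D n)).toNNReal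
      rw [show ⌊(ξ.toMeasure (D n)).toNNReal⌋₊ = m from h] at h1
      exact_mod_cast h1.le
    · simp
  infer_instance

/-- Integrals against a measurably chosen locally finite measure depend measurably on
parameters. -/
theorem measurable_lintegral_toMeasure {α : Type*} [MeasurableSpace α] {X : α → LFMeasure G}
    (hX : Measurable X) {f : α → G → ℝ≥0∞} (hf : Measurable (Function.uncurry f)) :
    Measurable fun a => ∫⁻ t, f a t ∂(X a).toMeasure :=
  Measurable.lintegral_kernel_prod_right (κ := (lfKernel G).comap X hX) hf

theorem measurable_lintegral_self {f : LFMeasure G → G → ℝ≥0∞}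
    (hf : Measurable (Function.uncurry f)) :
    Measurable fun ξ : LFMeasure G => ∫⁻ t, f ξ t ∂ξ.toMeasure :=
  measurable_lintegral_toMeasure measurable_id hf

end

section

variable {G : Type*} [AddCommGroup G] [TopologicalSpace G] [IsTopologicalAddGroup G]
  [MeasurableSpace G] [BorelSpace G]

theorem lintegral_shift (t : G) (ξ : LFMeasure G) (f : G → ℝ≥0∞) :
    ∫⁻ s, f s ∂(LFMeasure.shift t ξ).toMeasure = ∫⁻ s, f (s - t) ∂ξ.toMeasure :=
  (Homeomorph.subRight t).measurableEmbedding.lintegral_map _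

theorem shift_shift (s t : G) (ξ : LFMeasure G) :
    LFMeasure.shift s (LFMeasure.shift t ξ) = LFMeasure.shift (s + t) ξ := by
  refine LFMeasure.ext (Measure.ext fun A _ => ?_)
  simp only [LFMeasure.shift_apply]
  congr 1
  ext x
  simp [sub_sub, add_comm]

theorem shift_zero (ξ : LFMeasure G) : LFMeasure.shift 0 ξ = ξ := by
  refine LFMeasure.ext (Measure.ext fun A _ => ?_)
  simp [LFMeasure.shift_apply]

theorem shift_of_zero (t : G) : LFMeasure.shift t (0 : LFMeasure G) = 0 := by
  refine LFMeasure.ext (Measure.ext fun A _ => ?_)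
  rw [LFMeasure.shift_apply]; rfl

theorem shift_eq_zero_iff {t : G} {ξ : LFMeasure G} : LFMeasure.shift t ξ = 0 ↔ ξ = 0 := by
  refine ⟨fun h => ?_, fun h => by rw [h, shift_of_zero]⟩
  have := congrArg (LFMeasure.shift (-t)) h
  rwa [shift_shift, neg_add_cancel, shift_zero, shift_of_zero] at this

theorem measurable_displacement (B : PathSpace G) : Measurable fun t => t + B.toFun t :=
  (continuous_id.add B.continuous_toFun).measurable

variable [T2Space G]

theorem lintegral_perturb (ξ : LFMeasure G) (B : PathSpace G) {f : G → ℝ≥0∞}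
    (hf : Measurable f) :
    ∫⁻ s, f s ∂(perturb (ξ, B)).toMeasure = ∫⁻ t, f (t + B.toFun t) ∂ξ.toMeasure :=
  lintegral_map hf (measurable_displacement B)

/-- Recentring the perturbed measure at the displaced position of a point `t` amounts to perturbing
the measure recentred at `t` by the increments of the path from `t` on. -/
theorem shift_perturb (ξ : LFMeasure G) (B : PathSpace G) (t : G) :
    LFMeasure.shift (t + B.toFun t) (perturb (ξ, B)) =
      perturb (LFMeasure.shift t ξ, PathSpace.shift t B) := by
  refine LFMeasure.ext (Measure.ext_of_lintegral _ fun f hf => ?_)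
  rw [lintegral_shift,
    lintegral_perturb _ _ (show Measurable fun s => f (s - (t + B.toFun t)) by fun_prop),
    lintegral_perturb _ _ hf, lintegral_shift]
  refine lintegral_congr fun s => congrArg f ?_
  simp only [PathSpace.shift, add_sub_cancel]
  abel

theorem perturb_eq_zero_iff {ξ : LFMeasure G} {B : PathSpace G} :
    perturb (ξ, B) = 0 ↔ ξ = 0 := by
  have h : ∀ η : LFMeasure G, η = 0 ↔ η.toMeasure univ = 0 := fun η => by
    rw [Measure.measure_univ_eq_zero]
    exact ⟨fun h => by rw [h]; rfl, fun h => LFMeasure.ext h⟩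
  rw [h, h]
  simp only [perturb]
  rw [Measure.map_apply (measurable_displacement B) MeasurableSet.univ, preimage_univ]

variable [LocallyCompactSpace G] [SecondCountableTopology G]

theorem measurable_shift_uncurry :
    Measurable fun p : G × LFMeasure G => LFMeasure.shift p.1 p.2 := by
  refine measurable_lfMeasure_iff.2 fun K hK => ?_
  have : (fun p : G × LFMeasure G => (LFMeasure.shift p.1 p.2).toMeasure K) =
      fun p => ∫⁻ s, K.indicator 1 (s - p.1) ∂p.2.toMeasure := by
    funext p
    rw [← lintegral_shift, lintegral_indicator_one hK.measurableSet]
  rw [this]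
  refine measurable_lintegral_toMeasure measurable_snd ?_
  exact (measurable_one.indicator hK.measurableSet).comp
    (measurable_snd.sub (measurable_fst.comp measurable_fst))

@[fun_prop]
theorem _root_.Measurable.lfShift {α : Type*} [MeasurableSpace α] {u : α → G}
    {X : α → LFMeasure G} (hu : Measurable u) (hX : Measurable X) :
    Measurable fun a => LFMeasure.shift (u a) (X a) :=
  measurable_shift_uncurry.comp (hu.prodMk hX)

theorem measurable_path_uncurry : Measurable fun p : G × PathSpace G => p.2.toFun p.1 := by
  have := TopologicalSpace.metrizableSpace_of_t3_secondCountable G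
  refine measurable_uncurry_of_continuous_of_measurable
    (u := fun (t : G) (B : PathSpace G) => B.toFun t) (fun B => B.continuous_toFun) fun t => ?_
  exact Measurable.of_comap_le (le_iSup (fun s : G =>
    MeasurableSpace.comap (fun B : PathSpace G => B.toFun s) inferInstance) t)

@[fun_prop]
theorem _root_.Measurable.pathEval {α : Type*} [MeasurableSpace α] {u : α → G}
    {X : α → PathSpace G} (hu : Measurable u) (hX : Measurable X) :
    Measurable fun a => (X a).toFun (u a) :=
  measurable_path_uncurry.comp (hu.prodMk hX)

theorem measurable_perturb : Measurable (perturb : LFMeasure G × PathSpace G → LFMeasure G) := by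
  refine measurable_lfMeasure_iff.2 fun K hK => ?_
  have : (fun p : LFMeasure G × PathSpace G => (perturb p).toMeasure K) =
      fun p => ∫⁻ t, K.indicator 1 (t + p.2.toFun t) ∂p.1.toMeasure := by
    funext p
    rw [← lintegral_perturb p.1 p.2 (measurable_one.indicator hK.measurableSet),
      lintegral_indicator_one hK.measurableSet]
  rw [this]
  refine measurable_lintegral_toMeasure measurable_fst ?_
  exact (measurable_one.indicator hK.measurableSet).comp (by fun_prop)

end

/-! ### The refined Campbell formula and Mecke's exchange formula -/

section

theorem measure_ext_of_agree_on_finite {α : Type*} [MeasurableSpace α] (κ : Measure α)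
    [SigmaFinite κ] {μ₁ μ₂ : Measure α}
    (h : ∀ s, MeasurableSet s → κ s < ∞ → μ₁ s = μ₂ s) : μ₁ = μ₂ := by
  refine Measure.ext_of_iUnion_eq_univ (iUnion_spanningSets κ) fun n => ?_
  refine Measure.ext fun s hs => ?_
  rw [Measure.restrict_apply hs, Measure.restrict_apply hs]
  exact h _ (hs.inter (measurableSet_spanningSets κ n))
    ((measure_mono inter_subset_right).trans_lt (measure_spanningSets_lt_top κ n))

/-- The uniform density on a set of positive finite measure, with values in `ℝ≥0`. -/
theorem exists_uniform_density {α : Type*} [MeasurableSpace α] {μ : Measure α} {E : Set α}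
    (hE : MeasurableSet E) (h0 : μ E ≠ 0) (h1 : μ E ≠ ∞) :
    ∃ ω : α → ℝ≥0, Measurable ω ∧ (∀ t, (ω t : ℝ≥0∞) = E.indicator (fun _ => (μ E)⁻¹) t) ∧
      ∫⁻ t, (ω t : ℝ≥0∞) ∂μ = 1 := by
  have hval : ∀ t, ((E.indicator (fun _ => (μ E)⁻¹.toNNReal) t : ℝ≥0) : ℝ≥0∞) =
      E.indicator (fun _ => (μ E)⁻¹) t := fun t => by
    by_cases ht : t ∈ E
    · rw [indicator_of_mem ht, indicator_of_mem ht, ENNReal.coe_toNNReal (ENNReal.inv_ne_top.2 h0)]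
    · simp [ht]
  refine ⟨_, measurable_const.indicator hE, hval, ?_⟩
  simp_rw [hval]
  rw [lintegral_indicator_const hE, ENNReal.inv_mul_cancel h0 h1]

theorem exists_measure_pos_lt_top {G : Type*} [AddCommGroup G] [TopologicalSpace G]
    [MeasurableSpace G] [BorelSpace G] [LocallyCompactSpace G] [SecondCountableTopology G]
    [T2Space G] (haar : Measure G) [haar.IsAddHaarMeasure] :
    ∃ K : Set G, MeasurableSet K ∧ haar K ≠ 0 ∧ haar K ≠ ∞ := by
  obtain ⟨K⟩ : Nonempty (TopologicalSpace.PositiveCompacts G) := inferInstance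
  exact ⟨K, K.isCompact.measurableSet,
    (haar.measure_pos_of_nonempty_interior K.interior_nonempty).ne', K.isCompact.measure_lt_top.ne⟩

variable {G : Type*} [AddCommGroup G] [TopologicalSpace G] [IsTopologicalAddGroup G]
  [MeasurableSpace G] [BorelSpace G]

/-- The refined Campbell formula relating a measure `P` on `M(G)` to its Palm measure `Q`: the
integral form of the defining property of the Palm measure. -/
def IsCampbell (haar : Measure G) (P Q : Measure (LFMeasure G)) : Prop :=
  ∀ f : G × LFMeasure G → ℝ≥0∞, Measurable f →
    ∫⁻ ξ, ∫⁻ t, f (t, LFMeasure.shift t ξ) ∂ξ.toMeasure ∂P = ∫⁻ ξ, ∫⁻ t, f (t, ξ) ∂haar ∂Q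

/-- Mecke's exchange formula, the intrinsic property of a measure on `M(G)` that characterises
Palm measures of stationary measures. -/
def IsMecke (Q : Measure (LFMeasure G)) : Prop :=
  ∀ f : LFMeasure G × G → ℝ≥0∞, Measurable f →
    ∫⁻ ξ, ∫⁻ t, f (LFMeasure.shift t ξ, -t) ∂ξ.toMeasure ∂Q = ∫⁻ ξ, ∫⁻ t, f (ξ, t) ∂ξ.toMeasure ∂Q

variable {haar : Measure G} {P Q : Measure (LFMeasure G)}

theorem IsCampbell.isPalmMeasure (h : IsCampbell haar P Q) : IsPalmMeasure haar P Q := by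
  intro ω hω hint A hA
  rw [h (fun p => (ω p.1 : ℝ≥0∞) * A.indicator (fun _ => (1 : ℝ≥0∞)) p.2)
    ((hω.comp measurable_fst).coe_nnreal_ennreal.mul
      ((measurable_const.indicator hA).comp measurable_snd))]
  have : ∀ ξ, ∫⁻ t, (ω t : ℝ≥0∞) * A.indicator (fun _ => (1 : ℝ≥0∞)) ξ ∂haar =
      A.indicator 1 ξ := fun ξ => by
    rw [lintegral_mul_const _ hω.coe_nnreal_ennreal, hint, one_mul]; rfl
  simp_rw [this]
  rw [lintegral_indicator_one hA]

variable [T2Space G] [LocallyCompactSpace G] [SecondCountableTopology G]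

theorem IsPalmMeasure.apply_zero [haar.IsAddHaarMeasure] (h : IsPalmMeasure haar P Q) :
    Q {0} = 0 := by
  obtain ⟨K, hK, h0, h1⟩ := exists_measure_pos_lt_top haar
  obtain ⟨ω, hω, -, hint⟩ := exists_uniform_density hK h0 h1
  rw [h ω hω hint {0} measurableSet_singleton_zero, lintegral_eq_zero_of_ae_eq_zero]
  refine Eventually.of_forall fun ξ => ?_
  by_cases hξ : ξ = 0
  · subst hξ; exact lintegral_zero_measure _
  · simp [shift_eq_zero_iff, hξ]

/-- The defining property of the Palm measure for uniform densities gives the Campbell formula on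
rectangles `E ×ˢ A` with `E` of positive finite Haar measure, hence on all rectangles. -/
theorem IsPalmMeasure.isCampbell [haar.IsAddHaarMeasure] [SFinite P] [SigmaFinite Q]
    (h : IsPalmMeasure haar P Q) : IsCampbell haar P Q := by
  let C : Measure (G × LFMeasure G) :=
    (P ⊗ₘ lfKernel G).map fun p => (p.2, LFMeasure.shift p.2 p.1)
  have hCint : ∀ f : G × LFMeasure G → ℝ≥0∞, Measurable f →
      ∫⁻ p, f p ∂C = ∫⁻ ξ, ∫⁻ t, f (t, LFMeasure.shift t ξ) ∂ξ.toMeasure ∂P := by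
    intro f hf
    rw [lintegral_map hf (by fun_prop), Measure.lintegral_compProd (by fun_prop)]
    rfl
  have hpos : ∀ E, MeasurableSet E → haar E ≠ 0 → haar E ≠ ∞ → ∀ A, MeasurableSet A →
      C (E ×ˢ A) = haar E * Q A := by
    intro E hE h0 h1 A hA
    obtain ⟨ω, hω, hval, hint⟩ := exists_uniform_density hE h0 h1
    have key := h ω hω hint A hA
    simp_rw [hval] at key
    rw [← lintegral_indicator_one (hE.prod hA),
      hCint _ (measurable_one.indicator (hE.prod hA)), key, ← lintegral_const_mul']
    · refine lintegral_congr fun ξ => ?_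
      rw [← lintegral_const_mul' _ _ h1]
      refine lintegral_congr fun t => ?_
      by_cases ht : t ∈ E <;> by_cases hA' : LFMeasure.shift t ξ ∈ A <;>
        simp [ht, hA', ENNReal.mul_inv_cancel h0 h1]
    · exact h1
  -- A null set `E` is compared with `E ∪ K \ E`, where `K` has positive finite Haar measure.
  have hfin : ∀ E, MeasurableSet E → haar E < ∞ → ∀ A, MeasurableSet A → Q A < ∞ →
      C (E ×ˢ A) = haar E * Q A := by
    intro E hE h1 A hA hQA
    rcases eq_or_ne (haar E) 0 with h0 | h0
    · obtain ⟨K, hK, hK0, hK1⟩ := exists_measure_pos_lt_top haar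
      have hKm : MeasurableSet (K \ E) := hK.diff hE
      have hKE : haar (K \ E) = haar K := measure_sdiff_null h0
      have hu : haar (E ∪ K \ E) = haar K := by
        rw [measure_union disjoint_sdiff_right hKm, h0, hKE, zero_add]
      have e1 := hpos _ hKm (by rwa [hKE]) (by rwa [hKE]) A hA
      have e2 := hpos _ (hE.union hKm) (by rwa [hu]) (by rwa [hu]) A hA
      rw [union_prod, measure_union (disjoint_sdiff_right.set_prod_left A A) (hKm.prod hA), e1,
        hu, hKE] at e2
      have hne : haar K * Q A ≠ ∞ := ENNReal.mul_ne_top hK1 hQA.ne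
      rw [h0, zero_mul]
      exact (ENNReal.add_right_inj hne).1 (by rw [add_comm, e2, add_zero])
    · exact hpos E hE h0 h1.ne A hA
  have hE : ∀ E, MeasurableSet E → haar E < ∞ → ∀ A, MeasurableSet A →
      C (E ×ˢ A) = haar E * Q A := by
    intro E hE h1
    have := measure_ext_of_agree_on_finite Q (μ₁ := (C.restrict (E ×ˢ univ)).snd)
      (μ₂ := haar E • Q) fun A hA hQA => by
        rw [Measure.snd_apply hA, Measure.restrict_apply (measurable_snd hA), ← univ_prod,
          prod_inter_prod, univ_inter, inter_univ, hfin E hE h1 A hA hQA]; rfl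
    intro A hA
    have := congrArg (fun μ => μ A) this
    beta_reduce at this
    rw [Measure.snd_apply hA, Measure.restrict_apply (measurable_snd hA), ← univ_prod,
      prod_inter_prod, univ_inter, inter_univ] at this
    exact this
  have hprod : haar.prod Q = C := by
    refine Measure.prod_eq fun E A hEm hA => ?_
    have := measure_ext_of_agree_on_finite haar (μ₁ := (C.restrict (univ ×ˢ A)).fst)
      (μ₂ := Q A • haar) fun E hEm h1 => by
        rw [Measure.fst_apply hEm, Measure.restrict_apply (measurable_fst hEm), ← prod_univ,
          prod_inter_prod, univ_inter, inter_univ, hE E hEm h1 A hA, mul_comm]; rfl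
    have := congrArg (fun μ => μ E) this
    beta_reduce at this
    rw [Measure.fst_apply hEm, Measure.restrict_apply (measurable_fst hEm), ← prod_univ,
      prod_inter_prod, univ_inter, inter_univ] at this
    rw [this, mul_comm]; rfl
  intro f hf
  rw [← hCint f hf, ← hprod, lintegral_prod_symm' _ hf]

/-- Both sides are double integrals over pairs of points of `ξ`, with the two points exchanged. -/
theorem IsCampbell.isMecke [haar.IsAddHaarMeasure] (h : IsCampbell haar P Q) : IsMecke Q := by
  intro f hf
  obtain ⟨K, hK, hK0, hK1⟩ := exists_measure_pos_lt_top haar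
  obtain ⟨ω, hω, -, hint⟩ := exists_uniform_density hK hK0 hK1
  have hm1 : Measurable fun ξ : LFMeasure G =>
      ∫⁻ t, f (LFMeasure.shift t ξ, -t) ∂ξ.toMeasure :=
    measurable_lintegral_self (by unfold Function.uncurry; fun_prop)
  have h1 := h (fun p => (ω p.1 : ℝ≥0∞) * ∫⁻ t, f (LFMeasure.shift t p.2, -t) ∂p.2.toMeasure)
    (hω.coe_nnreal_ennreal.comp measurable_fst |>.mul (hm1.comp measurable_snd))
  have h2 := h (fun p => ∫⁻ u, (ω (u + p.1) : ℝ≥0∞) * f (p.2, u) ∂p.2.toMeasure)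
    (measurable_lintegral_toMeasure measurable_snd (by unfold Function.uncurry; fun_prop))
  have e1 : ∀ ξ, ∫⁻ t, (ω t : ℝ≥0∞) * ∫⁻ s, f (LFMeasure.shift s ξ, -s) ∂ξ.toMeasure ∂haar =
      ∫⁻ s, f (LFMeasure.shift s ξ, -s) ∂ξ.toMeasure := fun ξ => by
    rw [lintegral_mul_const _ hω.coe_nnreal_ennreal, hint, one_mul]
  have e2 : ∀ ξ : LFMeasure G, ∫⁻ t, ∫⁻ u, (ω (u + t) : ℝ≥0∞) * f (ξ, u) ∂ξ.toMeasure ∂haar =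
      ∫⁻ u, f (ξ, u) ∂ξ.toMeasure := fun ξ => by
    rw [lintegral_lintegral_swap (by unfold Function.uncurry; fun_prop)]
    refine lintegral_congr fun u => ?_
    rw [lintegral_mul_const _ (by fun_prop),
      lintegral_add_left_eq_self fun t => (ω t : ℝ≥0∞), hint, one_mul]
  simp only [e1] at h1
  simp only [e2] at h2
  rw [← h1, ← h2]
  refine lintegral_congr fun ξ => ?_
  simp only [lintegral_shift, shift_shift, sub_add_cancel, neg_sub]
  have : ∀ t, (ω t : ℝ≥0∞) * ∫⁻ s, f (LFMeasure.shift s ξ, t - s) ∂ξ.toMeasure =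
      ∫⁻ s, (ω t : ℝ≥0∞) * f (LFMeasure.shift s ξ, t - s) ∂ξ.toMeasure := fun t => by
    rw [lintegral_const_mul _ (by fun_prop)]
  simp only [this]
  rw [lintegral_lintegral_swap (by unfold Function.uncurry; fun_prop)]

end

/-! ### Mecke's characterisation: inversion of the Palm measure -/

section

variable {G : Type*} [TopologicalSpace G] [LocallyCompactSpace G] [SecondCountableTopology G]
  [MeasurableSpace G]

/-- A strictly positive function on `M(G) × G` whose integral against `ξ` is at most two. -/
def preWeight (p : LFMeasure G × G) : ℝ≥0∞ :=
  ∑' n, (2⁻¹ ^ n * (1 + p.1.toMeasure (compactCovering G n))⁻¹) *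
    (compactCovering G n).indicator 1 p.2

/-- A function on `M(G) × G` whose integral against every nonzero `ξ` is one. -/
def weight (p : LFMeasure G × G) : ℝ≥0∞ :=
  preWeight p / ∫⁻ s, preWeight (p.1, s) ∂p.1.toMeasure

theorem preWeight_ne_zero (p : LFMeasure G × G) : preWeight p ≠ 0 := by
  obtain ⟨n, hn⟩ := exists_mem_compactCovering p.2
  have hfin : p.1.toMeasure (compactCovering G n) ≠ ∞ :=
    (p.1.lt_top _ (isCompact_compactCovering G n)).ne
  intro h
  have := ENNReal.tsum_eq_zero.1 h n
  rw [indicator_of_mem hn, Pi.one_apply, mul_one, mul_eq_zero, ENNReal.inv_eq_zero] at this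
  rcases this with h | h
  · exact pow_ne_zero _ (ENNReal.inv_ne_zero.2 ENNReal.ofNat_ne_top) h
  · exact ENNReal.add_ne_top.2 ⟨ENNReal.one_ne_top, hfin⟩ h

variable [T2Space G] [BorelSpace G]

theorem measurable_preWeight : Measurable (preWeight : LFMeasure G × G → ℝ≥0∞) := by
  refine Measurable.tsum fun n => ?_
  have hK := isCompact_compactCovering G n
  have h1 : Measurable fun p : LFMeasure G × G => p.1.toMeasure (compactCovering G n) :=
    (measurable_eval_of_isCompact hK).comp measurable_fst
  have h2 : Measurable fun p : LFMeasure G × G =>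
      (compactCovering G n).indicator (1 : G → ℝ≥0∞) p.2 :=
    (measurable_one.indicator hK.measurableSet).comp measurable_snd
  fun_prop

@[fun_prop]
theorem measurable_preWeight_mk (ξ : LFMeasure G) : Measurable fun s => preWeight (ξ, s) :=
  measurable_preWeight.comp measurable_prodMk_left

theorem lintegral_preWeight_le (ξ : LFMeasure G) : ∫⁻ s, preWeight (ξ, s) ∂ξ.toMeasure ≤ 2 := by
  simp only [preWeight]
  have hm : ∀ n, Measurable ((compactCovering G n).indicator (1 : G → ℝ≥0∞)) := fun n =>
    measurable_one.indicator (isCompact_compactCovering G n).measurableSet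
  rw [lintegral_tsum fun n => ((hm n).const_mul _).aemeasurable]
  refine (ENNReal.tsum_le_tsum fun n => ?_).trans_eq ENNReal.tsum_geometric_two
  rw [lintegral_const_mul _ (hm n), lintegral_indicator_one
    (isCompact_compactCovering G n).measurableSet, mul_assoc]
  refine (mul_le_mul' le_rfl ?_).trans_eq (mul_one _)
  rw [mul_comm, ← div_eq_mul_inv]
  exact ENNReal.div_le_of_le_mul (by rw [one_mul]; exact le_add_self)

theorem lintegral_preWeight_ne_zero {ξ : LFMeasure G} (hξ : ξ ≠ 0) :
    ∫⁻ s, preWeight (ξ, s) ∂ξ.toMeasure ≠ 0 := by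
  rw [Ne, lintegral_eq_zero_iff (measurable_preWeight_mk ξ)]
  intro h
  refine hξ (LFMeasure.ext (ae_eq_bot.1 (eventually_false_iff_eq_bot.1 ?_)))
  exact h.mono fun s hs => preWeight_ne_zero _ hs

@[fun_prop]
theorem measurable_weight : Measurable (weight : LFMeasure G × G → ℝ≥0∞) :=
  measurable_preWeight.div (measurable_lintegral_toMeasure measurable_fst
    (measurable_preWeight.comp (by fun_prop)))

theorem lintegral_weight {ξ : LFMeasure G} (hξ : ξ ≠ 0) :
    ∫⁻ t, weight (ξ, t) ∂ξ.toMeasure = 1 := by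
  simp only [weight, div_eq_mul_inv]
  rw [lintegral_mul_const _ (measurable_preWeight_mk ξ), ENNReal.mul_inv_cancel
    (lintegral_preWeight_ne_zero hξ) ((lintegral_preWeight_le ξ).trans_lt ENNReal.ofNat_lt_top).ne]

end

section

variable {G : Type*} [AddCommGroup G] [TopologicalSpace G] [IsTopologicalAddGroup G]
  [MeasurableSpace G] [BorelSpace G]

/-- The measure on `M(G)` reconstructed from its Palm measure by the inversion formula
`P(A) = ∫ ∫ h(τ₋ₜ ξ, t) 1(τ₋ₜ ξ ∈ A) dt Q(dξ)`, where `h` is the function `weight`. -/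
def invPalm [LocallyCompactSpace G] [SecondCountableTopology G]
    (haar : Measure G) (Q : Measure (LFMeasure G)) : Measure (LFMeasure G) :=
  ((Q.prod haar).withDensity fun p => weight (LFMeasure.shift (-p.2) p.1, p.2)).map
    fun p => LFMeasure.shift (-p.2) p.1

variable [T2Space G] [LocallyCompactSpace G] [SecondCountableTopology G]
  {haar : Measure G} {P Q : Measure (LFMeasure G)}

theorem lintegral_invPalm [SFinite haar] {g : LFMeasure G → ℝ≥0∞} (hg : Measurable g) :
    ∫⁻ ξ, g ξ ∂invPalm haar Q = ∫⁻ ξ, ∫⁻ t, weight (LFMeasure.shift (-t) ξ, t) *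
      g (LFMeasure.shift (-t) ξ) ∂haar ∂Q := by
  rw [invPalm, lintegral_map hg (by fun_prop),
    lintegral_withDensity_eq_lintegral_mul _ (by fun_prop) (by fun_prop),
    lintegral_prod _ (by simp only [Pi.mul_def]; fun_prop)]
  rfl

/-- A measure on `M(G)` without mass at `0` is determined by its Palm measure. -/
theorem IsCampbell.eq_invPalm [SFinite haar] (h : IsCampbell haar P Q) (h0 : P {0} = 0) :
    P = invPalm haar Q := by
  refine Measure.ext_of_lintegral _ fun g hg => ?_
  rw [lintegral_invPalm hg, ← h (fun p => weight (LFMeasure.shift (-p.1) p.2, p.1) *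
      g (LFMeasure.shift (-p.1) p.2)) (by fun_prop)]
  have hne : ∀ᵐ ξ ∂P, ξ ≠ 0 := by simpa [ae_iff] using h0
  refine lintegral_congr_ae (hne.mono fun ξ hξ => ?_)
  simp only [shift_shift, neg_add_cancel, shift_zero]
  rw [lintegral_mul_const _ (by fun_prop), lintegral_weight hξ, one_mul]

theorem invPalm_apply_zero [SFinite haar] (h0 : Q {0} = 0) : invPalm haar Q {0} = 0 := by
  rw [← lintegral_indicator_one measurableSet_singleton_zero,
    lintegral_invPalm (measurable_one.indicator measurableSet_singleton_zero),
    lintegral_eq_zero_of_ae_eq_zero]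
  have hne : ∀ᵐ ξ ∂Q, ξ ≠ 0 := by simpa [ae_iff] using h0
  exact hne.mono fun ξ hξ => by simp [shift_eq_zero_iff, hξ]

/-- The reconstructed measure has Palm measure `Q`: writing out both integrals gives a double
integral over two points `s`, `t`, one against `ξ` and one against the Haar measure; the exchange
formula turns the integral of `f` against `ξ` into one of `weight`, which equals one. -/
theorem IsMecke.isCampbell_invPalm [haar.IsAddHaarMeasure] [SFinite Q] (h : IsMecke Q)
    (h0 : Q {0} = 0) : IsCampbell haar (invPalm haar Q) Q := by
  intro f hf
  rw [lintegral_invPalm (measurable_lintegral_self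
    (by unfold Function.uncurry; fun_prop))]
  have e := h (fun p => ∫⁻ t, weight (LFMeasure.shift (-t) p.1, t) *
    f (p.2 + t, LFMeasure.shift p.2 p.1) ∂haar) (Measurable.lintegral_prod_right' (f := fun q :
      (LFMeasure G × G) × G => weight (LFMeasure.shift (-q.2) q.1.1, q.2) *
    f (q.1.2 + q.2, LFMeasure.shift q.1.2 q.1.1)) (by fun_prop))
  calc _ = ∫⁻ ξ, ∫⁻ s, ∫⁻ t, weight (LFMeasure.shift (-t) ξ, t) *
        f (s + t, LFMeasure.shift s ξ) ∂haar ∂ξ.toMeasure ∂Q := by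
        refine lintegral_congr fun ξ => ?_
        rw [lintegral_lintegral_swap (by unfold Function.uncurry; fun_prop)]
        refine lintegral_congr fun t => ?_
        simp only [lintegral_shift, shift_shift, sub_neg_eq_add, add_neg_cancel_right]
        rw [lintegral_const_mul _ (by fun_prop)]
    _ = _ := by
        rw [← e]
        have hne : ∀ᵐ ξ ∂Q, ξ ≠ 0 := by simpa [ae_iff] using h0
        refine lintegral_congr_ae (hne.mono fun ξ hξ => ?_)
        simp only [shift_shift, neg_add_cancel, shift_zero]
        have : ∀ s, ∫⁻ t, weight (LFMeasure.shift (-t + s) ξ, t) * f (-s + t, ξ) ∂haar =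
            ∫⁻ t, weight (LFMeasure.shift (-t) ξ, t + s) * f (t, ξ) ∂haar := fun s => by
          rw [← lintegral_add_right_eq_self (fun t =>
            weight (LFMeasure.shift (-t + s) ξ, t) * f (-s + t, ξ)) s]
          refine lintegral_congr fun t => ?_
          rw [show -(t + s) + s = -t by abel, show -s + (t + s) = t by abel]
        simp only [this]
        rw [lintegral_lintegral_swap (by unfold Function.uncurry; fun_prop)]
        refine lintegral_congr fun t => ?_
        rw [lintegral_mul_const _ (by fun_prop)]
        have e2 := lintegral_weight (mt shift_eq_zero_iff.1 hξ : LFMeasure.shift (-t) ξ ≠ 0)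
        rw [lintegral_shift] at e2
        simp only [sub_neg_eq_add, add_comm _ t] at e2 ⊢
        rw [e2, one_mul]

/-- A positive integrable function for `haar.prod Q`, summed over the points of `ξ`, is positive
for `ξ ≠ 0`. -/
theorem IsCampbell.sigmaFinite [SigmaFinite haar] [SigmaFinite Q] (h : IsCampbell haar P Q)
    (h0 : P {0} = 0) : SigmaFinite P := by
  obtain ⟨g, hpos, hg, hlt⟩ := exists_pos_lintegral_lt_of_sigmaFinite (haar.prod Q) one_ne_zero
  have e := h (fun p => (g p : ℝ≥0∞)) hg.coe_nnreal_ennreal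
  rw [← lintegral_prod_symm' _ hg.coe_nnreal_ennreal] at e
  refine sigmaFinite_of_lintegral_ne_top (measurable_lintegral_self
    (by unfold Function.uncurry; fun_prop)) ?_ (e.trans_lt hlt).ne_top
  have hne : ∀ᵐ ξ ∂P, ξ ≠ 0 := by simpa [ae_iff] using h0
  refine hne.mono fun ξ hξ => ?_
  rw [Ne, lintegral_eq_zero_iff (by fun_prop)]
  intro h
  refine hξ (LFMeasure.ext (ae_eq_bot.1 (eventually_false_iff_eq_bot.1 ?_)))
  exact h.mono fun s hs => (hpos _).ne' (by simpa using hs)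

theorem IsCampbell.map_shift [haar.IsAddHaarMeasure] (h : IsCampbell haar P Q) (u : G) :
    IsCampbell haar (P.map (LFMeasure.shift u)) Q := by
  intro f hf
  rw [lintegral_map (measurable_lintegral_self
    (by unfold Function.uncurry; fun_prop)) (measurable_shift u)]
  simp only [lintegral_shift, shift_shift, sub_add_cancel]
  rw [h (fun p => f (p.1 - u, p.2)) (by fun_prop)]
  exact lintegral_congr fun ξ => lintegral_sub_right_eq_self (fun t => f (t, ξ)) u

/-- Stationarity comes for free: a translate of `P` has the same Palm measure as `P`. -/
theorem IsCampbell.isStationary [haar.IsAddHaarMeasure] [SigmaFinite Q]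
    (h : IsCampbell haar P Q) (h0 : P {0} = 0) : IsStationary P := by
  refine ⟨h.sigmaFinite h0, fun u => ?_⟩
  have hz : P.map (LFMeasure.shift u) {0} = 0 := by
    rw [Measure.map_apply (measurable_shift u) measurableSet_singleton_zero]
    convert h0 using 2
    ext ξ
    simp [shift_eq_zero_iff]
  rw [(h.map_shift u).eq_invPalm hz, ← h.eq_invPalm h0]

/-- **Mecke's theorem**: a σ-finite measure without mass at `0` that satisfies the exchange formula
is the Palm measure of exactly one stationary measure without mass at `0`. -/
theorem IsMecke.existsUnique_isStationaryWithPalm [haar.IsAddHaarMeasure] [SigmaFinite Q]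
    (h : IsMecke Q) (h0 : Q {0} = 0) : ∃! P, IsStationaryWithPalm haar P Q := by
  have hC := h.isCampbell_invPalm (haar := haar) h0
  have hz := invPalm_apply_zero (haar := haar) h0
  refine ⟨invPalm haar Q, ⟨hC.isStationary hz, hz, hC.isPalmMeasure⟩, fun P ⟨hP, hPz, hPQ⟩ => ?_⟩
  have := hP.1
  exact hPQ.isCampbell.eq_invPalm hPz

end

/-! ### Counting measures -/

open TopologicalSpace in
/-- A measure has finite support iff the number of pairwise disjoint basic open sets that it
charges is bounded. This describes counting measures by countably many masses of Borel sets. -/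
theorem exists_finite_null_iff {G : Type*} [TopologicalSpace G] [SecondCountableTopology G]
    [T2Space G] [MeasurableSpace G] {μ : Measure G} :
    (∃ S : Set G, S.Finite ∧ μ Sᶜ = 0) ↔ ∃ k : ℕ, ∀ t : Finset (countableBasis G),
      (t : Set (countableBasis G)).PairwiseDisjoint (fun U => (U : Set G)) → k < t.card →
        ∃ U ∈ t, μ U = 0 := by
  constructor
  · rintro ⟨S, hS, h0⟩
    refine ⟨hS.toFinset.card, fun t ht hk => ?_⟩
    by_contra! hne
    have hmeet : ∀ U ∈ t, ∃ x ∈ S, x ∈ (U : Set G) := fun U hU => by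
      by_contra! hdis
      exact hne U hU (measure_mono_null (fun x hxU hxS => hdis x hxS hxU) h0)
    have : Nonempty G := by
      obtain ⟨U, hU⟩ := Finset.card_pos.1 (Nat.zero_lt_of_lt hk)
      exact ⟨(hmeet U hU).choose⟩
    choose! c hcS hcU using hmeet
    refine hk.not_ge (Finset.card_le_card_of_injOn c (fun U hU => by simpa using hcS U hU) ?_)
    intro U hU V hV hUV
    by_contra hne
    exact disjoint_left.1 (ht hU hV hne) (hcU U hU) (hUV ▸ hcU V hV)
  · rintro ⟨k, hk⟩
    refine ⟨μ.support, ?_, Measure.measure_compl_support⟩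
    by_contra hinf
    obtain ⟨s, hsub, hcard⟩ := (show μ.support.Infinite from hinf).exists_subset_card_eq (k + 1)
    obtain ⟨U, hU, hdisj⟩ := s.finite_toSet.t2_separation
    have hB : ∀ x, ∃ V : countableBasis G, x ∈ (V : Set G) ∧ (V : Set G) ⊆ U x := fun x => by
      obtain ⟨V, hV, hxV, hVU⟩ := (isBasis_countableBasis G).exists_subset_of_mem_open
        (hU x).1 (hU x).2
      exact ⟨⟨V, hV⟩, hxV, hVU⟩
    choose V hxV hVU using hB
    classical
    have hinj : InjOn V s := fun x hx y hy hxy => by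
      by_contra hne
      exact disjoint_left.1 (hdisj hx hy hne) (hVU x (hxV x)) (hVU y (hxy ▸ hxV x))
    have hpd : ((s.image V : Finset (countableBasis G)) : Set (countableBasis G)).PairwiseDisjoint
        fun U => (U : Set G) := by
      intro A hA B hB hAB
      obtain ⟨x, hx, rfl⟩ := Finset.mem_image.1 (Finset.mem_coe.1 hA)
      obtain ⟨y, hy, rfl⟩ := Finset.mem_image.1 (Finset.mem_coe.1 hB)
      exact (hdisj hx hy fun h => hAB (h ▸ rfl)).mono (hVU x) (hVU y)
    obtain ⟨W, hW, hW0⟩ := hk _ hpd (by rw [Finset.card_image_of_injOn hinj, hcard]; omega)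
    obtain ⟨x, hx, rfl⟩ := Finset.mem_image.1 hW
    have := (Measure.mem_support_iff_forall x).1 (hsub hx) _
      ((isOpen_of_mem_countableBasis (V x).2).mem_nhds (hxV x))
    exact this.ne' hW0

section

variable {G : Type*} [TopologicalSpace G] [LocallyCompactSpace G] [SecondCountableTopology G]

theorem countable_of_finite_inter_isCompact {F : Set G}
    (hF : ∀ K : Set G, IsCompact K → (F ∩ K).Finite) : F.Countable := by
  rw [← inter_univ F, ← iUnion_compactCovering, inter_iUnion]
  exact countable_iUnion fun n => (hF _ (isCompact_compactCovering G n)).countable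

variable [T2Space G] [MeasurableSpace G] [BorelSpace G]

/-- A locally finite measure is a counting measure as soon as it is carried by a locally finite
set, some of whose points may have mass zero. -/
theorem isCounting_iff_exists_compl_null {ξ : LFMeasure G} :
    ξ.IsCounting ↔ ∃ F : Set G, (∀ K : Set G, IsCompact K → (F ∩ K).Finite) ∧
      ξ.toMeasure Fᶜ = 0 := by
  constructor
  · rintro ⟨F, m, hF, -, hξ⟩
    refine ⟨F, hF, ?_⟩
    rw [hξ, Measure.sum_apply _ (countable_of_finite_inter_isCompact hF).measurableSet.compl,
      ENNReal.tsum_eq_zero]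
    intro x
    simp
  · rintro ⟨F, hF, h0⟩
    let F' : Set G := {x ∈ F | ξ.toMeasure {x} ≠ 0}
    have hF'F : F' ⊆ F := fun x hx => hx.1
    have hFc := countable_of_finite_inter_isCompact hF
    have hF'c : F'.Countable := hFc.mono hF'F
    refine ⟨F', fun x => (ξ.toMeasure {x}).toNNReal,
      fun K hK => (hF K hK).subset (inter_subset_inter_left _ hF'F), fun x hx =>
      ENNReal.toNNReal_pos hx.2 (ξ.lt_top _ isCompact_singleton).ne, ?_⟩
    have hcompl : ξ.toMeasure F'ᶜ = 0 := by
      have h1 : ξ.toMeasure (⋃ x ∈ F \ F', {x}) = 0 :=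
        (measure_biUnion_null_iff (hFc.mono sdiff_subset)).2 fun x hx => by
          by_contra h
          exact hx.2 ⟨hx.1, h⟩
      refine measure_mono_null (fun x hx => ?_) (measure_union_null h0 h1)
      by_cases hxF : x ∈ F
      · exact Or.inr (mem_biUnion ⟨hxF, hx⟩ rfl)
      · exact Or.inl hxF
    have := hF'c.to_subtype
    have hdisj : Pairwise (Function.onFun Disjoint fun x : F' => ({(x : G)} : Set G)) :=
      fun x y hxy => disjoint_singleton.2 fun h => hxy (Subtype.ext h)
    calc ξ.toMeasure = ξ.toMeasure.restrict (⋃ x : F', {(x : G)}) := by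
          rw [iUnion_singleton_eq_range, Subtype.range_coe]
          exact (Measure.restrict_eq_self_of_ae_mem hcompl).symm
      _ = _ := by
          rw [Measure.restrict_iUnion hdisj fun x => measurableSet_singleton _]
          congr 1
          funext x
          rw [Measure.restrict_singleton, ← Measure.coe_nnreal_smul,
            ENNReal.coe_toNNReal (ξ.lt_top _ isCompact_singleton).ne]

theorem isCounting_zero : (0 : LFMeasure G).IsCounting :=
  isCounting_iff_exists_compl_null.2 ⟨∅, fun K _ => by simp, rfl⟩

/-- Counting measures are those with finitely many atoms on every compact set and no diffuse
part. -/
theorem isCounting_iff_forall_exhaustion (E : CompactExhaustion G) {ξ : LFMeasure G} :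
    ξ.IsCounting ↔ ∀ n, ∃ S : Set G, S.Finite ∧ ξ.toMeasure (E n \ S) = 0 := by
  rw [isCounting_iff_exists_compl_null]
  constructor
  · rintro ⟨F, hF, h0⟩ n
    refine ⟨F ∩ E n, hF _ (E.isCompact n), ?_⟩
    exact measure_mono_null (fun x (hx : x ∈ E n \ (F ∩ E n)) hxF => hx.2 ⟨hxF, hx.1⟩) h0
  · intro h
    choose S hS h0 using h
    have hsub : ∀ n x, x ∈ E n → ξ.toMeasure {x} ≠ 0 → x ∈ S n := fun n x hx hne => by
      by_contra hxS
      exact hne (measure_mono_null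
        (singleton_subset_iff.2 (show x ∈ E n \ S n from ⟨hx, hxS⟩)) (h0 n))
    refine ⟨{x | ξ.toMeasure {x} ≠ 0}, fun K hK => ?_, ?_⟩
    · obtain ⟨n, hn⟩ := E.exists_superset_of_isCompact hK
      exact (hS n).subset fun x hx => hsub n x (hn hx.2) hx.1
    · have h1 : ξ.toMeasure (⋃ n, E n \ S n) = 0 := measure_iUnion_null h0
      have h2 : ξ.toMeasure (⋃ n, ⋃ x ∈ {x ∈ S n | ξ.toMeasure {x} = 0}, {x}) = 0 :=
        measure_iUnion_null fun n =>
          (measure_biUnion_null_iff ((hS n).subset (sep_subset _ _)).countable).2 fun x hx => hx.2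
      refine measure_mono_null (fun x hx => ?_) (measure_union_null h1 h2)
      obtain ⟨n, hn⟩ : ∃ n, x ∈ E n := mem_iUnion.1 (E.iUnion_eq ▸ mem_univ x)
      by_cases hxS : x ∈ S n
      · exact Or.inr (mem_iUnion.2 ⟨n, mem_biUnion ⟨hxS, by simpa using hx⟩ rfl⟩)
      · exact Or.inl (mem_iUnion.2 ⟨n, hn, hxS⟩)

open TopologicalSpace in
theorem measurableSet_isCounting : MeasurableSet {ξ : LFMeasure G | ξ.IsCounting} := by
  let E := CompactExhaustion.choice G
  have hset : {ξ : LFMeasure G | ξ.IsCounting} = ⋂ n, ⋃ k : ℕ, ⋂ t : Finset (countableBasis G),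
      ⋂ (_ : (t : Set (countableBasis G)).PairwiseDisjoint fun U => (U : Set G)),
      ⋂ (_ : k < t.card), ⋃ U ∈ t, {ξ : LFMeasure G | ξ.toMeasure (U ∩ E n) = 0} := by
    ext ξ
    rw [mem_ofPred_eq, isCounting_iff_forall_exhaustion E]
    simp only [mem_iInter, mem_iUnion, mem_ofPred_eq, exists_prop]
    refine forall_congr' fun n => ?_
    have hm : ∀ U : countableBasis G, ξ.toMeasure (U ∩ E n) = ξ.toMeasure.restrict (E n) U :=
      fun U => (Measure.restrict_apply (isOpen_of_mem_countableBasis U.2).measurableSet).symm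
    simp only [hm]
    rw [← exists_finite_null_iff]
    refine exists_congr fun S => and_congr_right fun hS => ?_
    rw [Measure.restrict_apply hS.measurableSet.compl, inter_comm, sdiff_eq]
  rw [hset]
  refine .iInter fun n => .iUnion fun k => .iInter fun t => .iInter fun _ => .iInter fun _ =>
    .biUnion (Finset.countable_toSet t) fun U _ => ?_
  exact ((Measure.measurable_coe ((isOpen_of_mem_countableBasis U.2).measurableSet.inter
    (E.isCompact n).measurableSet)).comp measurable_toMeasure) (measurableSet_singleton 0)

end

section

variable {G : Type*} [AddCommGroup G] [TopologicalSpace G] [IsTopologicalAddGroup G]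
  [MeasurableSpace G] [BorelSpace G] [T2Space G] [LocallyCompactSpace G]
  [SecondCountableTopology G]

theorem LFMeasure.IsCounting.shift {ξ : LFMeasure G} (h : ξ.IsCounting) (t : G) :
    (LFMeasure.shift t ξ).IsCounting := by
  obtain ⟨F, hF, h0⟩ := isCounting_iff_exists_compl_null.1 h
  refine isCounting_iff_exists_compl_null.2 ⟨(fun s => s + t) ⁻¹' F, fun K hK => ?_, ?_⟩
  · have := (hF _ (hK.image (Homeomorph.addRight t).continuous)).preimage
      (add_left_injective t).injOn
    exact this.subset fun x hx => ⟨hx.1, mem_image_of_mem _ hx.2⟩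
  · rw [LFMeasure.shift_apply]
    simpa [preimage_preimage, ← preimage_compl] using h0

theorem isCounting_shift_iff {ξ : LFMeasure G} {t : G} :
    (LFMeasure.shift t ξ).IsCounting ↔ ξ.IsCounting :=
  ⟨fun h => by simpa [shift_shift, shift_zero] using LFMeasure.IsCounting.shift h (-t),
    fun h => LFMeasure.IsCounting.shift h t⟩

/-- A path in `F(G)` sends the locally finite set `F` to a locally finite set, because it sends
the locally finite measure `∑_{x ∈ F} δ_x` to a locally finite measure. -/
theorem LFMeasure.IsCounting.perturb {ξ : LFMeasure G} (h : ξ.IsCounting) (B : PathSpace G) :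
    (PalmPerturbation.perturb (ξ, B)).IsCounting := by
  obtain ⟨F, hF, h0⟩ := isCounting_iff_exists_compl_null.1 h
  have hFc := countable_of_finite_inter_isCompact hF
  let η : LFMeasure G := ⟨Measure.count.restrict F, fun K hK => by
    rw [Measure.restrict_apply hK.measurableSet, inter_comm]
    exact Measure.count_apply_lt_top.2 (hF K hK)⟩
  have hFin : ∀ K, IsCompact K → ((fun t => t + B.toFun t) '' F ∩ K).Finite := fun K hK => by
    have h1 := (PalmPerturbation.perturb (η, B)).lt_top K hK
    simp only [PalmPerturbation.perturb, η] at h1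
    rw [Measure.map_apply (measurable_displacement B) hK.measurableSet,
      Measure.restrict_apply (measurable_displacement B hK.measurableSet),
      Measure.count_apply_lt_top] at h1
    rw [inter_comm, ← image_preimage_inter]
    exact h1.image _
  refine isCounting_iff_exists_compl_null.2 ⟨_, hFin, ?_⟩
  simp only [PalmPerturbation.perturb]
  rw [Measure.map_apply (measurable_displacement B) (hFc.image _).measurableSet.compl]
  exact measure_mono_null (fun x hx hxF => hx (mem_image_of_mem _ hxF)) h0

variable {haar : Measure G} {P Q : Measure (LFMeasure G)}

/-- Being a counting measure is translation invariant, so the refined Campbell formula identifies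
the weighted mass `∫ ξ(G) 1(ξ ∉ N(G)) P(dξ)` with `λ(G) Q(N(G)ᶜ)`. -/
theorem IsCampbell.supportedOnCounting_iff [haar.IsAddHaarMeasure] (h : IsCampbell haar P Q) :
    SupportedOnCounting P ↔ SupportedOnCounting Q := by
  let A : Set (LFMeasure G) := {ξ | ξ.IsCounting}ᶜ
  have hA : MeasurableSet A := measurableSet_isCounting.compl
  have hiff : ∀ (t : G) ξ, LFMeasure.shift t ξ ∈ A ↔ ξ ∈ A := fun t ξ =>
    not_congr isCounting_shift_iff
  have key : ∫⁻ ξ, A.indicator 1 ξ * ξ.toMeasure univ ∂P = haar univ * Q A := by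
    have e := h (fun p => A.indicator 1 p.2) ((measurable_one.indicator hA).comp measurable_snd)
    simp only [lintegral_const] at e
    rw [lintegral_mul_const _ (measurable_one.indicator hA), lintegral_indicator_one hA,
      mul_comm] at e
    rw [← e]
    refine lintegral_congr fun ξ => ?_
    rw [← lintegral_const]
    refine lintegral_congr fun t => ?_
    by_cases hξ : ξ ∈ A <;> simp [hiff, hξ]
  have hm : Measurable fun ξ : LFMeasure G => A.indicator 1 ξ * ξ.toMeasure univ :=
    (measurable_one.indicator hA).mul
      ((Measure.measurable_coe MeasurableSet.univ).comp measurable_toMeasure)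
  have hQ : SupportedOnCounting Q ↔ haar univ * Q A = 0 := by
    rw [mul_eq_zero, or_iff_right (NeZero.ne (haar univ))]
    rfl
  rw [hQ, ← key, lintegral_eq_zero_iff hm]
  refine eventually_congr (Eventually.of_forall fun ξ => ?_)
  by_cases hξ : ξ.IsCounting
  · simp [A, hξ]
  · have : ξ.toMeasure ≠ 0 := fun h0 => hξ ((LFMeasure.ext h0 : ξ = 0) ▸ isCounting_zero)
    simp [A, hξ, this]

end

/-! ### Perturbation of Palm measures -/

section

variable {G : Type*} [AddCommGroup G] [TopologicalSpace G] [IsTopologicalAddGroup G]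
  [MeasurableSpace G] [BorelSpace G] [T2Space G] [LocallyCompactSpace G]
  [SecondCountableTopology G] {Q : Measure (LFMeasure G)} {ν : Measure (PathSpace G)}

theorem lintegral_perturbedPalm [SFinite ν] {g : LFMeasure G → ℝ≥0∞} (hg : Measurable g) :
    ∫⁻ ξ, g ξ ∂perturbedPalm Q ν = ∫⁻ ξ, ∫⁻ B, g (perturb (ξ, B)) ∂ν ∂Q := by
  rw [perturbedPalm, lintegral_map hg measurable_perturb]
  exact lintegral_prod _ (hg.comp measurable_perturb).aemeasurable

theorem perturbedPalm_apply_zero [SFinite ν] (h0 : Q {0} = 0) : perturbedPalm Q ν {0} = 0 := by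
  rw [← lintegral_indicator_one measurableSet_singleton_zero,
    lintegral_perturbedPalm (measurable_one.indicator measurableSet_singleton_zero),
    lintegral_eq_zero_of_ae_eq_zero]
  have hne : ∀ᵐ ξ ∂Q, ξ ≠ 0 := by simpa [ae_iff] using h0
  exact hne.mono fun ξ hξ => by simp [perturb_eq_zero_iff, hξ]

/-- A σ-finite perturbed measure can only arise from a σ-finite measure: a positive integrable
function of `ξ_B` becomes one of `ξ` on integrating out `B`. -/
theorem sigmaFinite_of_perturbedPalm [SFinite ν] [SigmaFinite (perturbedPalm Q ν)] (hν : ν ≠ 0) :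
    SigmaFinite Q := by
  obtain ⟨g, hpos, hg, hlt⟩ :=
    exists_pos_lintegral_lt_of_sigmaFinite (perturbedPalm Q ν) one_ne_zero
  rw [lintegral_perturbedPalm hg.coe_nnreal_ennreal] at hlt
  have hm : Measurable fun p : LFMeasure G × PathSpace G => (g (perturb p) : ℝ≥0∞) :=
    (hg.comp measurable_perturb).coe_nnreal_ennreal
  refine sigmaFinite_of_lintegral_ne_top hm.lintegral_prod_right'
    (Eventually.of_forall fun ξ h => ?_) hlt.ne_top
  rw [lintegral_eq_zero_iff (show Measurable fun B => (g (perturb (ξ, B)) : ℝ≥0∞) from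
    hm.comp measurable_prodMk_left)] at h
  refine hν (ae_eq_bot.1 (eventually_false_iff_eq_bot.1 ?_))
  exact h.mono fun B hB => (hpos _).ne' (by simpa using hB)

/-- The exchange formula survives the perturbation: recentring `ξ_B` at `t + B t` replaces `(ξ, B)`
by `(τ_t ξ, θ_t B)`, the path `θ_t B` may be replaced by `B` by weak stationarity, and what remains
is the exchange formula for `Q`. -/
theorem IsMecke.perturbedPalm (h : IsMecke Q) (hν : IsWeaklyStationary ν) :
    IsMecke (perturbedPalm Q ν) := by
  have := hν.1
  intro f hf
  have hm := measurable_perturb (G := G)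
  rw [lintegral_perturbedPalm (measurable_lintegral_self (by unfold Function.uncurry; fun_prop)),
    lintegral_perturbedPalm (measurable_lintegral_self (by unfold Function.uncurry; fun_prop))]
  have e := h (fun p => ∫⁻ B, f (perturb (p.1, B), p.2 + B.toFun p.2) ∂ν)
    (Measurable.lintegral_prod_right' (f := fun q : (LFMeasure G × G) × PathSpace G =>
      f (perturb (q.1.1, q.2), q.1.2 + q.2.toFun q.1.2)) (by fun_prop))
  calc _ = ∫⁻ ξ, ∫⁻ t, ∫⁻ B, f (perturb (LFMeasure.shift t ξ, PathSpace.shift t B),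
          -t + (PathSpace.shift t B).toFun (-t)) ∂ν ∂ξ.toMeasure ∂Q := by
        refine lintegral_congr fun ξ => ?_
        have e1 : ∀ B, ∫⁻ t, f (LFMeasure.shift t (perturb (ξ, B)), -t)
            ∂(perturb (ξ, B)).toMeasure =
            ∫⁻ t, f (LFMeasure.shift (t + B.toFun t) (perturb (ξ, B)), -(t + B.toFun t))
              ∂ξ.toMeasure := fun B => lintegral_perturb _ _
                (f := fun t => f (LFMeasure.shift t (perturb (ξ, B)), -t)) (by fun_prop)
        simp only [e1]
        rw [lintegral_lintegral_swap (by unfold Function.uncurry; fun_prop)]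
        refine lintegral_congr fun t => lintegral_congr fun B => ?_
        rw [shift_perturb]
        congr 2
        simp only [PathSpace.shift, add_neg_cancel, B.map_zero]
        abel
    _ = ∫⁻ ξ, ∫⁻ t, ∫⁻ B, f (perturb (LFMeasure.shift t ξ, B), -t + B.toFun (-t)) ∂ν
          ∂ξ.toMeasure ∂Q := by
        refine lintegral_congr fun ξ => lintegral_congr fun t => ?_
        conv_rhs => rw [← hν.2 t]
        rw [lintegral_map (by fun_prop) (measurable_pathShift t)]
    _ = ∫⁻ ξ, ∫⁻ t, ∫⁻ B, f (perturb (ξ, B), t + B.toFun t) ∂ν ∂ξ.toMeasure ∂Q := e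
    _ = _ := by
        refine lintegral_congr fun ξ => ?_
        rw [lintegral_lintegral_swap (by unfold Function.uncurry; fun_prop)]
        refine lintegral_congr fun B => ?_
        exact (lintegral_perturb ξ B (f := fun t => f (perturb (ξ, B), t)) (by fun_prop)).symm

theorem SupportedOnCounting.perturbedPalm [SFinite ν] (h : SupportedOnCounting Q) :
    SupportedOnCounting (perturbedPalm Q ν) := by
  have hA := measurableSet_isCounting (G := G).compl
  change PalmPerturbation.perturbedPalm Q ν {ξ : LFMeasure G | ξ.IsCounting}ᶜ = 0
  rw [← lintegral_indicator_one hA, lintegral_perturbedPalm (measurable_one.indicator hA),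
    lintegral_eq_zero_of_ae_eq_zero]
  exact h.mono fun ξ hξ => by simp [hξ.perturb]

end

end PalmPerturbation

end

open PalmPerturbation in
theorem mainTheorem5 {G : Type*} [AddCommGroup G] [TopologicalSpace G] [IsTopologicalAddGroup G]
    [T2Space G] [LocallyCompactSpace G] [SecondCountableTopology G]
    [MeasurableSpace G] [BorelSpace G]
    (haar : Measure G) [haar.IsAddHaarMeasure]
    (P P₀ : Measure (LFMeasure G)) (ν : Measure (PathSpace G))
    (hP : IsStationary P) (hP₀ : IsPalmMeasure haar P P₀)
    (hν : IsWeaklyStationary ν)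
    (hσ : SigmaFinite (perturbedPalm P₀ ν))
    (hN : SupportedOnCounting P) :
    (∃! Pν : Measure (LFMeasure G), IsStationaryWithPalm haar Pν (perturbedPalm P₀ ν)) ∧
      ∀ Pν : Measure (LFMeasure G), IsStationaryWithPalm haar Pν (perturbedPalm P₀ ν) →
        SupportedOnCounting Pν := by
  have := hP.1
  have := hν.1
  have hprops : IsMecke (perturbedPalm P₀ ν) ∧ SupportedOnCounting (perturbedPalm P₀ ν) := by
    rcases eq_or_ne ν 0 with rfl | hν0
    · -- `P₀` need not be σ-finite in this case, but the perturbed measure is zero.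
      have h0 : perturbedPalm P₀ (0 : Measure (PathSpace G)) = 0 := by simp [perturbedPalm]
      rw [h0]
      exact ⟨fun f _ => by simp, by simp [SupportedOnCounting]⟩
    · have := sigmaFinite_of_perturbedPalm (Q := P₀) hν0
      have hC := hP₀.isCampbell
      exact ⟨hC.isMecke.perturbedPalm hν, (hC.supportedOnCounting_iff.1 hN).perturbedPalm⟩
  refine ⟨hprops.1.existsUnique_isStationaryWithPalm (perturbedPalm_apply_zero hP₀.apply_zero),
    fun Pν ⟨hstat, _, hpalm⟩ => ?_⟩
  have := hstat.1
  exact hpalm.isCampbell.supportedOnCounting_iff.2 hprops.2
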